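/- Let $G$ be a countable group acting by measurable, measure-preserving transformations on a standard Borel probability space $(X,\mu)$, and suppose that the action is ergodic. For $g\in G$ put $$\varphi(g)=\mu(X_g),\qquad X_g=\{x\in X: gx=x\}.$$ Let $\Pi=\{(x,y)\in X\times X: y=gx \text{ for some } g\in G\}$ be the graph of the action, with the $\sigma$-finite measure $M(A)=\int_X \#\{y:(x,y)\in A\cap\Pi\}\,d\mu(x)$. On $L^2(\Pi,M)$ consider the unitary operators $(U_gh)(x,y)=h(g^{-1}x,y)$, $g\in G$, and the operators $(M_fh)(x,y)=f(x)h(x,y)$ of multiplication by bounded measurable functions $f$ on $X$. The $U_g$ and $M_f$ together form the groupoid representation of the skew product of $G$ and $L^\infty(X)$; the von Neumann algebra generated by all $U_g$ and all $M_f$ is the factor $\mathcal M$ of this representation. Let $1_\Delta\in L^2(\Pi,M)$ be the indicator function of the diagonal $\Delta=\{(x,x):x\in X\}$. A character of $G$ is a function $\psi:G\to\mathbb C$ that is nonnegative definite (for all $n$ and $g_1,\dots,g_n\in G$ the matrix $(\psi(g_ig_j^{-1}))_{i,j=1}^n$ is positive semidefinite), central ($\psi(ghg^{-1})=\psi(h)$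 for all $g,h\in G$) and normalized ($\psi(\mathrm{id})=1$); it is indecomposable if it is an extreme point of the convex set of all characters of $G$. Then: 1. $\varphi$ is a character of $G$; 2. $\langle U_g1_\Delta,1_\Delta\rangle=\varphi(g)$ for every $g\in G$; 3. if the restriction of the groupoid representation to $G$ generates the whole factor, that is, if the von Neumann algebra generated by $\{U_g: g\in G\}$ equals $\mathcal M$, then the character $\varphi$ is indecomposable. -/

import Mathlib

open MeasureTheory
open scoped ENNReal ComplexOrder

noncomputable section

namespace GroupoidRep

section Characters

variable {G : Type*} [Group G]

/-- A character of a group `G`: a nonnegative definite, central, normalized complex function. -/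
structure IsCharacter (φ : G → ℂ) : Prop where
  posDef : ∀ (n : ℕ) (g : Fin n → G),
    (Matrix.of fun i j : Fin n => φ (g i * (g j)⁻¹)).PosSemidef
  central : ∀ g h : G, φ (g * h * g⁻¹) = φ h
  normalized : φ 1 = 1

/-- An indecomposable character: an extreme point of the convex set of all characters. -/
def IsIndecomposableCharacter (φ : G → ℂ) : Prop :=
  φ ∈ Set.extremePoints ℝ {ψ : G → ℂ | IsCharacter ψ}

end Characters

section VonNeumann

variable {H : Type*} [NormedAddCommGroup H] [InnerProductSpace ℂ H] [CompleteSpace H]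

/-- The von Neumann algebra (`W*`-algebra) generated by a set `S` of bounded operators: the double
commutant of `S ∪ S*` (`StarSubalgebra.centralizer` is the commutant of the star-closure). -/
def vonNeumannGenerated (S : Set (H →L[ℂ] H)) : VonNeumannAlgebra H where
  toStarSubalgebra :=
    StarSubalgebra.centralizer ℂ (StarSubalgebra.centralizer ℂ S : Set (H →L[ℂ] H))
  centralizer_centralizer' := by
    change Set.centralizer (Set.centralizer
      ((StarSubalgebra.centralizer ℂ (StarSubalgebra.centralizer ℂ S : Set (H →L[ℂ] H)) :
        StarSubalgebra ℂ (H →L[ℂ] H)) : Set (H →L[ℂ] H))) =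
      ((StarSubalgebra.centralizer ℂ (StarSubalgebra.centralizer ℂ S : Set (H →L[ℂ] H)) :
        StarSubalgebra ℂ (H →L[ℂ] H)) : Set (H →L[ℂ] H))
    rw [StarSubalgebra.coe_centralizer_centralizer, Set.centralizer_centralizer_centralizer]

end VonNeumann

section Measure

variable (G : Type*) [Group G] {X : Type*} [MeasurableSpace X] [MulAction G X]

/-- The graph of the action (the orbit equivalence relation): pairs `(x, y)` with `y = g x`
for some `g`. -/
def graph (X : Type*) [MulAction G X] : Set (X × X) := {p | ∃ g : G, p.2 = g • p.1}

/-- The number of points of `A` in the layer over `x`: the number of `y` with `(x, y)` in `A` and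
in the graph of the action. -/
def layerCount (A : Set (X × X)) (x : X) : ℝ≥0∞ :=
  Measure.count {y : X | (x, y) ∈ A ∩ graph G X}

variable [StandardBorelSpace X]

theorem layerCount_iUnion [Countable G] {A : ℕ → Set (X × X)}
    (hd : Pairwise (Function.onFun Disjoint A)) (x : X) :
    layerCount G (⋃ i, A i) x = ∑' i, layerCount G (A i) x := by
  have hc : ∀ B : Set (X × X), MeasurableSet {y : X | (x, y) ∈ B ∩ graph G X} := by
    intro B
    refine Set.Countable.measurableSet ((Set.countable_range fun g : G => g • x).mono ?_)
    rintro y ⟨-, g, hg⟩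
    exact ⟨g, hg.symm⟩
  unfold layerCount
  rw [← measure_iUnion _ fun i => hc (A i)]
  · congr 1
    ext y
    simp [graph]
  · intro i j hij
    refine Set.disjoint_left.2 fun y hy hy' => ?_
    exact Set.disjoint_left.1 (hd hij) hy.1 hy'.1

theorem measurable_layerCount [Countable G] [MeasurableConstSMul G X]
    {A : Set (X × X)} (hA : MeasurableSet A) : Measurable (layerCount G A) := by
  classical
  obtain ⟨e, he⟩ := exists_surjective_nat G
  have key : ∀ x, layerCount G A x = ∑' n : ℕ,
      Set.indicator ({x : X | (x, e n • x) ∈ A} ∩ ⋂ m ∈ Set.Iio n, {x : X | e m • x = e n • x}ᶜ)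
        (fun _ => (1 : ℝ≥0∞)) x := by
    intro x
    set B : ℕ → Set X :=
      fun n => {y | y = e n • x ∧ (x, e n • x) ∈ A ∧ ∀ m < n, e m • x ≠ e n • x} with hB
    have hBs : ∀ n, (B n).Subsingleton := fun n y hy z hz => hy.1.trans hz.1.symm
    have hU : {y : X | (x, y) ∈ A ∩ graph G X} = ⋃ n, B n := by
      ext y
      simp only [Set.mem_ofPred_eq, Set.mem_iUnion]
      constructor
      · rintro ⟨hyA, g, hg⟩
        obtain ⟨n, rfl⟩ := he g
        simp only at hg
        have hex : ∃ n, y = e n • x := ⟨n, hg⟩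
        refine ⟨Nat.find hex, Nat.find_spec hex, ?_, fun m hm h => ?_⟩
        · rw [← Nat.find_spec hex]
          exact hyA
        · exact Nat.find_min hex hm ((Nat.find_spec hex).trans h.symm)
      · rintro ⟨n, hy, hA', -⟩
        exact ⟨by rw [hy]; exact hA', e n, hy⟩
    have hdisj : Pairwise (Function.onFun Disjoint B) := by
      intro i j hij
      refine Set.disjoint_left.2 fun y hy hy' => ?_
      rcases lt_or_gt_of_ne hij with h | h
      · exact hy'.2.2 i h (hy.1.symm.trans hy'.1)
      · exact hy.2.2 j h (hy'.1.symm.trans hy.1)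
    unfold layerCount
    rw [hU, measure_iUnion hdisj fun n => (hBs n).measurableSet]
    refine tsum_congr fun n => ?_
    by_cases h : (x, e n • x) ∈ A ∧ ∀ m < n, e m • x ≠ e n • x
    · have : B n = {e n • x} := by
        ext y
        simp only [hB, Set.mem_ofPred_eq, Set.mem_singleton_iff]
        exact ⟨fun hy => hy.1, fun hy => ⟨hy, h⟩⟩
      rw [this, Measure.count_singleton, Set.indicator_of_mem]
      simpa using h
    · have : B n = ∅ := by
        ext y
        simp only [hB, Set.mem_ofPred_eq, Set.mem_empty_iff_false, iff_false]
        exact fun hy => h hy.2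
      rw [this, measure_empty, Set.indicator_of_notMem]
      simpa using h
  rw [funext key]
  refine Measurable.tsum fun n => measurable_const.indicator ?_
  refine MeasurableSet.inter ?_ ?_
  · exact (measurable_id.prodMk (measurable_const_smul (e n))) hA
  · refine MeasurableSet.biInter (Set.to_countable _) fun m _ => MeasurableSet.compl ?_
    exact measurableSet_eq_fun (measurable_const_smul (e m)) (measurable_const_smul (e n))

variable [Countable G] [MeasurableConstSMul G X]

/-- The measure `M` on the graph of the action (seen as a measure on `X × X` concentrated on the
graph): its projection is `μ`, and the conditional measures on the layers are counting measures,
i.e. `M A = ∫ #{y | (x, y) ∈ A, y ∈ G x} dμ(x)`. -/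
def graphMeasure (μ : Measure X) : Measure (X × X) :=
  Measure.ofMeasurable (fun A _ => ∫⁻ x, layerCount G A x ∂μ)
    (by simp [layerCount])
    (by
      intro A hA hd
      simp_rw [layerCount_iUnion G hd]
      exact lintegral_tsum fun i => (measurable_layerCount G (hA i)).aemeasurable)

variable (μ : Measure X)

theorem graphMeasure_apply {A : Set (X × X)} (hA : MeasurableSet A) :
    graphMeasure G μ A = ∫⁻ x, layerCount G A x ∂μ :=
  Measure.ofMeasurable_apply A hA

theorem graphMeasure_compl_graph : graphMeasure G μ (graph G X)ᶜ = 0 := by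
  have hm : MeasurableSet (graph G X) := by
    have : graph G X = ⋃ g : G, {p : X × X | p.2 = g • p.1} := by
      ext p; simp [graph]
    rw [this]
    exact MeasurableSet.iUnion fun g =>
      measurableSet_eq_fun measurable_snd (measurable_fst.const_smul g)
  rw [graphMeasure_apply G μ hm.compl]
  simp [layerCount]

theorem graphMeasure_diagonal : graphMeasure G μ (Set.diagonal X) = μ Set.univ := by
  rw [graphMeasure_apply G μ measurableSet_diagonal]
  have : ∀ x : X, layerCount G (Set.diagonal X) x = 1 := by
    intro x
    have : {y : X | (x, y) ∈ Set.diagonal X ∩ graph G X} = {x} := by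
      ext y
      simp only [Set.mem_ofPred_eq, Set.mem_inter_iff, Set.mem_diagonal_iff, Set.mem_singleton_iff]
      exact ⟨fun h => h.1.symm, fun h => ⟨h.symm, 1, by simp [h]⟩⟩
    rw [layerCount, this, Measure.count_singleton]
  simp [this]

/-- The left action `(x, y) ↦ (g x, y)` preserves `M`. -/
theorem measurePreserving_left [SMulInvariantMeasure G X μ] (g : G) :
    MeasurePreserving (fun p : X × X => (g • p.1, p.2)) (graphMeasure G μ) (graphMeasure G μ) := by
  have hm : Measurable fun p : X × X => (g • p.1, p.2) :=
    (measurable_fst.const_smul g).prodMk measurable_snd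
  refine ⟨hm, Measure.ext fun A hA => ?_⟩
  rw [Measure.map_apply hm hA, graphMeasure_apply G μ hA, graphMeasure_apply G μ (hm hA)]
  rw [← (measurePreserving_smul g μ).lintegral_comp (measurable_layerCount G hA)]
  refine lintegral_congr fun x => ?_
  unfold layerCount
  congr 1
  ext y
  simp only [graph, Set.mem_ofPred_eq, Set.mem_inter_iff, Set.mem_preimage]
  refine and_congr_right fun _ => ⟨?_, ?_⟩
  · rintro ⟨k, hk⟩
    exact ⟨k * g⁻¹, by rw [hk, smul_smul]; simp⟩
  · rintro ⟨k, hk⟩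
    exact ⟨k * g, by rw [hk, mul_smul]⟩

/-- The Hilbert space `L²(Π, M)` of the graph `Π` of the action. -/
abbrev L2 : Type _ := Lp ℂ 2 (graphMeasure G μ)

/-- The groupoid (trajectory, von Neumann) representation restricted to the group:
`(U_g h)(x, y) = h(g⁻¹ x, y)` on `L²(Π, M)`. -/
def groupoidRep [SMulInvariantMeasure G X μ] : G →* (L2 G μ ≃ₗᵢ[ℂ] L2 G μ) where
  toFun g :=
    { toLinearEquiv := LinearEquiv.ofLinearMap
        (Lp.compMeasurePreservingₗ ℂ _ (measurePreserving_left G μ g⁻¹))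
        (Lp.compMeasurePreservingₗ ℂ _ (measurePreserving_left G μ g))
        (by
          ext1 h
          change Lp.compMeasurePreserving _ (measurePreserving_left G μ g⁻¹)
            (Lp.compMeasurePreserving _ (measurePreserving_left G μ g) h) = h
          rw [← Lp.compMeasurePreserving_comp_apply]
          convert Lp.compMeasurePreserving_id_apply h
          funext p
          simp)
        (by
          ext1 h
          change Lp.compMeasurePreserving _ (measurePreserving_left G μ g)
            (Lp.compMeasurePreserving _ (measurePreserving_left G μ g⁻¹) h) = h
          rw [← Lp.compMeasurePreserving_comp_apply]
          convert Lp.compMeasurePreserving_id_apply h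
          funext p
          simp)
      norm_map' := fun h => Lp.norm_compMeasurePreserving h (measurePreserving_left G μ g⁻¹) }
  map_one' := by
    ext1 h
    change Lp.compMeasurePreserving _ (measurePreserving_left G μ 1⁻¹) h = h
    convert Lp.compMeasurePreserving_id_apply h
    all_goals simp
  map_mul' a b := by
    ext1 h
    change Lp.compMeasurePreserving _ (measurePreserving_left G μ (a * b)⁻¹) h =
      Lp.compMeasurePreserving _ (measurePreserving_left G μ a⁻¹)
        (Lp.compMeasurePreserving _ (measurePreserving_left G μ b⁻¹) h)
    rw [← Lp.compMeasurePreserving_comp_apply]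
    congr 2
    funext p
    simp [mul_smul]

theorem coeFn_groupoidRep [SMulInvariantMeasure G X μ] (g : G) (h : L2 G μ) :
    groupoidRep G μ g h =ᵐ[graphMeasure G μ] fun p => h (g⁻¹ • p.1, p.2) :=
  Lp.coeFn_compMeasurePreserving h (measurePreserving_left G μ g⁻¹)

/-- The operators `U_g`, as bounded operators on `L²(Π, M)`. -/
def groupOperators [SMulInvariantMeasure G X μ] : Set (L2 G μ →L[ℂ] L2 G μ) :=
  Set.range fun g : G => ((groupoidRep G μ g).toContinuousLinearEquiv : L2 G μ →L[ℂ] L2 G μ)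

/-- For a bounded measurable `f` on `X`, the operator of multiplication by `f(x)` on
`L²(Π, M)`. -/
def multiplier (f : X → ℂ) (hf : Measurable f) (hb : ∃ C : ℝ, ∀ x, ‖f x‖ ≤ C) :
    L2 G μ →L[ℂ] L2 G μ :=
  (ContinuousLinearMap.mul ℂ ℂ).holderL (graphMeasure G μ) ∞ 2 2
    (MemLp.toLp (fun p : X × X => f p.1) <|
      memLp_top_of_bound (hf.comp measurable_fst).aestronglyMeasurable hb.choose
        (Filter.Eventually.of_forall fun p => hb.choose_spec p.1))

theorem coeFn_multiplier (f : X → ℂ) (hf : Measurable f) (hb : ∃ C : ℝ, ∀ x, ‖f x‖ ≤ C)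
    (h : L2 G μ) :
    multiplier G μ f hf hb h =ᵐ[graphMeasure G μ] fun p => f p.1 * h p := by
  have hm : MemLp (fun p : X × X => f p.1) ∞ (graphMeasure G μ) :=
    memLp_top_of_bound (hf.comp measurable_fst).aestronglyMeasurable hb.choose
      (Filter.Eventually.of_forall fun p => hb.choose_spec p.1)
  filter_upwards [(ContinuousLinearMap.mul ℂ ℂ).coeFn_holder (r := 2) (hm.toLp _) h,
    hm.coeFn_toLp] with p h1 h2
  refine Eq.trans h1 ?_
  rw [h2]
  rfl

/-- The operators of multiplication by bounded measurable functions of `x`. -/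
def multipliers : Set (L2 G μ →L[ℂ] L2 G μ) :=
  {T | ∃ (f : X → ℂ) (hf : Measurable f) (hb : ∃ C : ℝ, ∀ x, ‖f x‖ ≤ C),
    T = multiplier G μ f hf hb}

/-- The `W*`-algebra of the groupoid representation of the skew product of `G` and `L^∞(X)`
(a factor when the action is ergodic): it is generated by the operators `U_g` and the
multiplication operators. -/
def groupoidAlgebra [SMulInvariantMeasure G X μ] : VonNeumannAlgebra (L2 G μ) :=
  vonNeumannGenerated (groupOperators G μ ∪ multipliers G μ)

/-- The `W*`-algebra generated by the operators `U_g` alone, i.e. by the restriction of the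
groupoid representation to the group. -/
def groupAlgebra [SMulInvariantMeasure G X μ] : VonNeumannAlgebra (L2 G μ) :=
  vonNeumannGenerated (groupOperators G μ)

/-- The characteristic function of the diagonal, as an element of `L²(Π, M)`. -/
def diagonalVector [IsFiniteMeasure μ] : L2 G μ :=
  indicatorConstLp 2 (measurableSet_diagonal : MeasurableSet (Set.diagonal X))
    (by rw [graphMeasure_diagonal]; exact measure_ne_top μ _) (1 : ℂ)

/-- The function `φ(g) = μ(X_g) = μ {x | g x = x}`. -/
def fixedPointFunction {G : Type*} [Group G] {X : Type*} [MeasurableSpace X] [MulAction G X]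
    (μ : Measure X) (g : G) : ℂ :=
  (μ.real {x : X | g • x = x} : ℂ)

end Measure

end GroupoidRep

end

/-!
The vectors `v g = U_g 1_Δ` have Gram kernel `φ (g h⁻¹)`: the vector `v g` is the indicator of the
graph of `g⁻¹`, and the graph of a translation meets the diagonal in its fixed points. This gives
the formula for `φ` and its positivity; centrality is the invariance of `μ`.

For indecomposability, let `φ = a ψ + b ψ'` with `a, b > 0`. The kernel `ψ (g h⁻¹)` is dominated by a
multiple of the Gram kernel of the `v g`, so it is the matrix of a bounded operator `T` on
`L²(Π, M)`, zero on the orthogonal complement of the `v g`; see `exists_clm_of_kernel_le_gram`.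
The operators `U_g` and the right translations `(V_g h)(x, y) = h(x, g⁻¹ y)` permute the `v h` and
preserve the kernel of `ψ`, so `T` commutes with both. Since the `U_g` generate the groupoid
algebra, `T` commutes with multiplication by functions of `x`. The swap of coordinates preserves `M`
and exchanges `U_g` with `V_g`, hence the same argument gives that `T` commutes with multiplication
by functions of `y`. So `T 1_Δ` is supported on the diagonal (`ae_eq_zero_off_diagonal`), and it is
invariant under `U_g V_g`; by ergodicity `T 1_Δ = c 1_Δ`. Then `ψ` is a multiple of `φ`, and the
normalization makes them equal.
-/

universe u

noncomputable section

namespace GroupoidRep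

/-! ### Kernels dominated by a Gram kernel -/

section Hilbert

open scoped InnerProductSpace

/-- A positive semidefinite kernel is the Gram kernel of vectors in a Hilbert space: the kernel
functions of its reproducing kernel Hilbert space (over scalar functions). -/
theorem exists_gram_eq {ι : Type u} {k : Matrix ι ι ℂ} (hk : k.PosSemidef) :
    ∃ (F : Type u) (_ : NormedAddCommGroup F) (_ : InnerProductSpace ℂ F) (_ : CompleteSpace F)
      (w : ι → F), ∀ i j, ⟪w i, w j⟫_ℂ = k i j := by
  -- The reproducing kernel space takes an operator-valued kernel; scalars act on `ℂ`.
  let K : Matrix ι ι (ℂ →L[ℂ] ℂ) := .of fun i j => k i j • ContinuousLinearMap.id ℂ ℂ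
  have hK : K.PosSemidef := by
    refine ((RKHS.posSemidef_tfae (K := K)).out 0 2 rfl rfl).2 ⟨?_, fun c => ?_⟩
    · refine Matrix.IsHermitian.ext fun i j => ?_
      have := hk.1.apply i j
      simp only [K, Matrix.of_apply, star_smul, this]
      congr 1
      simp [star, ContinuousLinearMap.adjoint_id]
    · have h := (Complex.le_def.1 (hk.2 c)).1
      have e : (c.sum fun x w => c.sum fun x' w' => ⟪K x' x w, w'⟫_ℂ) =
          star (c.sum fun i xi => c.sum fun j xj => star xi * k i j * xj) := by
        rw [Finsupp.sum_comm]
        simp only [Finsupp.sum, star_sum]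
        refine Finset.sum_congr rfl fun x _ => Finset.sum_congr rfl fun x' _ => ?_
        simp [K]
        ring
      rw [e]
      simp only [RCLike.star_def, RCLike.conj_re]
      exact h
  have : Fact K.PosSemidef := ⟨hK⟩
  refine ⟨RKHS.OfKernel K, inferInstance, inferInstance, inferInstance,
    fun i => RKHS.kerFun (RKHS.OfKernel K) i 1, fun i j => ?_⟩
  rw [← RKHS.kernel_inner, RKHS.OfKernel.kernel_ofKernel, ← inner_conj_symm]
  have := hk.1.apply i j
  simp [K, ← this]

variable {H : Type*} [NormedAddCommGroup H] [InnerProductSpace ℂ H] [CompleteSpace H]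

/-- Two bounded operators agree if they agree on a family of vectors and on its orthogonal
complement. -/
theorem clm_ext_of_family {ι F : Type*} [NormedAddCommGroup F] [NormedSpace ℂ F] (v : ι → H)
    {f g : H →L[ℂ] F} (hv : ∀ i, f (v i) = g (v i))
    (hp : ∀ y, (∀ i, ⟪v i, y⟫_ℂ = 0) → f y = g y) : f = g := by
  let K := (Submodule.span ℂ (Set.range v)).topologicalClosure
  have hK : Set.EqOn f g K := by
    have : Set.EqOn f g (Submodule.span ℂ (Set.range v)) := by
      refine LinearMap.eqOn_span (f := f.toLinearMap) (g := g.toLinearMap) ?_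
      rintro _ ⟨i, rfl⟩
      exact hv i
    exact this.closure f.continuous g.continuous
  ext x
  obtain ⟨y, hy, z, hz, rfl⟩ := K.exists_add_mem_mem_orthogonal x
  rw [map_add, map_add, hK hy, hp z fun i => ?_]
  exact hz _ (Submodule.le_topologicalClosure _ (Submodule.subset_span ⟨i, rfl⟩))

/-- If the norm of each linear combination of the `w i` is bounded by that of the corresponding
combination of the `v i`, then `v i ↦ w i` extends to a bounded operator that vanishes on the
orthogonal complement of the `v i`. -/
theorem exists_clm_of_dominated {ι F : Type*} [NormedAddCommGroup F] [InnerProductSpace ℂ F]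
    [CompleteSpace F] (v : ι → H) (w : ι → F) (C : ℝ)
    (h : ∀ c : ι →₀ ℂ, ‖Finsupp.linearCombination ℂ w c‖ ≤
      C * ‖Finsupp.linearCombination ℂ v c‖) :
    ∃ A : H →L[ℂ] F, (∀ i, A (v i) = w i) ∧ ∀ y, (∀ i, ⟪v i, y⟫_ℂ = 0) → A y = 0 := by
  let K := (Submodule.span ℂ (Set.range v)).topologicalClosure
  have hmem : ∀ c, Finsupp.linearCombination ℂ v c ∈ K := fun c =>
    Submodule.le_topologicalClosure _ (by
      rw [← Finsupp.range_linearCombination]; exact ⟨c, rfl⟩)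
  let e : (ι →₀ ℂ) →ₗ[ℂ] K := (Finsupp.linearCombination ℂ v).codRestrict K hmem
  have hd : DenseRange e := by
    intro x
    rw [closure_subtype]
    have hx := x.2
    have : ((↑) '' Set.range e : Set H) = Submodule.span ℂ (Set.range v) := by
      rw [← Finsupp.range_linearCombination, ← Set.range_comp]
      rfl
    rw [this]
    exact hx
  -- Extend from the span to its closure `K` by continuity, then precompose with the projection.
  let B := (Finsupp.linearCombination ℂ w).extendOfNorm e
  have hB : ∀ c, B (e c) = Finsupp.linearCombination ℂ w c :=
    LinearMap.extendOfNorm_eq hd ⟨C, h⟩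
  refine ⟨B ∘L K.orthogonalProjectionOnto, fun i => ?_, fun y hy => ?_⟩
  · have h1 : K.orthogonalProjectionOnto (v i) = e (Finsupp.single i 1) := by
      have : (e (Finsupp.single i 1) : H) = v i := by simp [e]
      rw [← this, Submodule.orthogonalProjectionOnto_mem_subspace_eq_self]
    simp [h1, hB]
  · have : y ∈ Kᗮ := by
      rw [Submodule.orthogonal_closure]
      rw [Submodule.mem_orthogonal]
      intro u hu
      induction hu using Submodule.span_induction with
      | mem x hx => obtain ⟨i, rfl⟩ := hx; exact hy i
      | zero => simp
      | add a b _ _ ha hb => rw [inner_add_left, ha, hb, add_zero]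
      | smul a b _ hb => rw [inner_smul_left, hb, mul_zero]
    simp [Submodule.orthogonalProjectionOnto_apply_of_mem_orthogonal this]

theorem sum_sum_inner_eq_norm_sq {ι E : Type*} [NormedAddCommGroup E] [InnerProductSpace ℂ E]
    (z : ι → E) (c : ι →₀ ℂ) :
    (c.sum fun i xi => c.sum fun j xj => star xi * ⟪z i, z j⟫_ℂ * xj) =
      ((‖Finsupp.linearCombination ℂ z c‖ ^ 2 : ℝ) : ℂ) := by
  have h := inner_self_eq_norm_sq_to_K (𝕜 := ℂ) (Finsupp.linearCombination ℂ z c)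
  rw [Finsupp.linearCombination_apply, Finsupp.sum_inner] at h
  simp only [Finsupp.inner_sum, inner_smul_left, inner_smul_right] at h
  rw [Finsupp.linearCombination_apply]
  push_cast
  refine Eq.trans ?_ h
  refine Finsupp.sum_congr fun i _ => ?_
  refine Finsupp.sum_congr fun j _ => ?_
  simp only [RCLike.star_def]
  ring

/-- Radon–Nikodym theorem for positive semidefinite kernels: if `a • k`, with `a > 0`, is dominated
by the Gram kernel of the `v i`, then `k` is the matrix of a bounded operator `T` on the family
`v i`. The operator is zero on the orthogonal complement of the family, hence it is determined by
`k`, and every unitary that permutes the `v i` and preserves `k` commutes with it. -/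
theorem exists_clm_of_kernel_le_gram {ι : Type*} (v : ι → H) {k : Matrix ι ι ℂ}
    (hk : k.PosSemidef) {a : ℝ} (ha : 0 < a)
    (hle : (Matrix.gram ℂ v - a • k).PosSemidef) :
    ∃ T : H →L[ℂ] H, (∀ i j, ⟪T (v i), v j⟫_ℂ = k i j) ∧
      ∀ (U : H ≃ₗᵢ[ℂ] H) (σ : Equiv.Perm ι), (∀ i, U (v i) = v (σ i)) →
        (∀ i j, k (σ i) (σ j) = k i j) → ∀ x, T (U x) = U (T x) := by
  obtain ⟨F, _, _, _, w, hw⟩ := exists_gram_eq hk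
  have hbound : ∀ c : ι →₀ ℂ, ‖Finsupp.linearCombination ℂ w c‖ ≤
      √a⁻¹ * ‖Finsupp.linearCombination ℂ v c‖ := by
    intro c
    have h := hle.2 c
    have e : (c.sum fun i xi => c.sum fun j xj =>
        star xi * (Matrix.gram ℂ v - a • k) i j * xj) =
        ((‖Finsupp.linearCombination ℂ v c‖ ^ 2 -
          a * ‖Finsupp.linearCombination ℂ w c‖ ^ 2 : ℝ) : ℂ) := by
      push_cast
      rw [← Complex.ofReal_pow, ← Complex.ofReal_pow, ← sum_sum_inner_eq_norm_sq,
        ← sum_sum_inner_eq_norm_sq]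
      simp only [Finsupp.mul_sum, ← Finsupp.sum_sub, hw]
      refine Finsupp.sum_congr fun i _ => Finsupp.sum_congr fun j _ => ?_
      simp
      ring
    rw [e, Complex.zero_le_real] at h
    refine le_of_sq_le_sq ?_ (by positivity)
    rw [mul_pow, Real.sq_sqrt (by positivity), inv_mul_eq_div, le_div_iff₀ ha]
    linarith
  obtain ⟨A, hA, hA0⟩ := exists_clm_of_dominated v w _ hbound
  -- `A` is zero off the span of the `v i`, so `A† A` depends only on `k`.
  refine ⟨A.adjoint ∘L A, fun i j => ?_, fun U σ hU hσ => ?_⟩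
  · simp [ContinuousLinearMap.adjoint_inner_left, hA, hw]
  have hperp : ∀ y, (∀ i, ⟪v i, y⟫_ℂ = 0) → ∀ i, ⟪v i, U y⟫_ℂ = 0 := by
    intro y hy i
    rw [← σ.apply_symm_apply i, ← hU, U.inner_map_map, hy]
  obtain ⟨AU, hAU'⟩ : ∃ AU : H →L[ℂ] F, ∀ x, AU x = A (U x) :=
    ⟨A ∘L (U.toContinuousLinearEquiv : H →L[ℂ] H), fun _ => rfl⟩
  have hAU : AU.adjoint ∘L AU = A.adjoint ∘L A := by
    refine clm_ext_of_family v (fun i => ?_) fun y hy => ?_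
    · refine (InnerProductSpace.toDual ℂ H).injective ?_
      refine clm_ext_of_family v (fun j => ?_) fun y hy => ?_
      · simp [hAU', ContinuousLinearMap.adjoint_inner_left, hU, hA, hw, hσ]
      · simp [hAU', ContinuousLinearMap.adjoint_inner_left, hA0 y hy, hA0 _ (hperp y hy)]
    · simp [hAU', hA0 y hy, hA0 _ (hperp y hy)]
  intro x
  refine U.symm.injective ?_
  rw [U.symm_apply_apply]
  refine ext_inner_right ℂ fun y => ?_
  have := congrArg (fun L : H →L[ℂ] H => ⟪L x, y⟫_ℂ) hAU
  simp only [ContinuousLinearMap.comp_apply, ContinuousLinearMap.adjoint_inner_left] at this ⊢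
  rw [← this, U.symm.inner_map_eq_flip]
  simp [hAU', ContinuousLinearMap.adjoint_inner_left]

end Hilbert

/-! ### Characters as kernels on the whole group -/

section Characters

variable {G : Type*} [Group G]

/-- Positivity of the finite matrices `ψ (g i * (g j)⁻¹)` gives positivity of the kernel on all of
`G`, since quadratic forms of infinite matrices are only evaluated at finitely supported vectors. -/
theorem IsCharacter.posSemidef {ψ : G → ℂ} (hψ : IsCharacter ψ) :
    (Matrix.of fun g h : G => ψ (g * h⁻¹)).PosSemidef := by
  refine ⟨Matrix.IsHermitian.ext fun g h => ?_, fun c => ?_⟩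
  · simpa using (hψ.posDef 2 ![g, h]).1.apply 0 1
  · let e := c.support.equivFin.symm
    have h := (Matrix.posSemidef_iff_dotProduct_mulVec.1
      (hψ.posDef _ fun i => (e i : G))).2 fun i => c (e i)
    convert h using 1
    simp only [Finsupp.sum, dotProduct, Matrix.mulVec, Finset.mul_sum, Pi.star_apply]
    rw [← Finset.sum_coe_sort, ← e.sum_comp]
    refine Finset.sum_congr rfl fun i _ => ?_
    rw [← Finset.sum_coe_sort, ← e.sum_comp]
    refine Finset.sum_congr rfl fun j _ => ?_
    simp [mul_assoc]

end Characters

/-! ### Symmetry of the measure on the graph and the right translations -/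

section GraphMeasure

variable (G : Type*) [Group G] {X : Type*} [MeasurableSpace X] [MulAction G X]
  [StandardBorelSpace X] [Countable G] [MeasurableConstSMul G X] (μ : Measure X)

omit [Countable G] in
theorem measurableSet_translationGraph (g : G) :
    MeasurableSet {p : X × X | p.2 = g • p.1} :=
  measurableSet_eq_fun measurable_snd (measurable_fst.const_smul g)

/-- On the graph of the translation by `g`, the measure `M` is the image of `μ` under
`x ↦ (x, g • x)`: the layer over `x` has one point. -/
theorem graphMeasure_restrict_translationGraph (g : G) :
    (graphMeasure G μ).restrict {p | p.2 = g • p.1} = μ.map fun x => (x, g • x) := by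
  have hm : Measurable fun x : X => (x, g • x) := measurable_id.prodMk (measurable_const_smul g)
  ext A hA
  rw [Measure.restrict_apply hA, Measure.map_apply hm hA,
    graphMeasure_apply G μ (hA.inter (measurableSet_translationGraph G g)),
    ← lintegral_indicator_one (hm hA)]
  refine lintegral_congr fun x => ?_
  by_cases hx : (x, g • x) ∈ A
  · have : {y : X | (x, y) ∈ A ∩ {p | p.2 = g • p.1} ∩ graph G X} = {g • x} := by
      ext y
      constructor
      · exact fun h => h.1.2
      · rintro rfl
        exact ⟨⟨hx, rfl⟩, g, rfl⟩
    rw [layerCount, this, Measure.count_singleton, Set.indicator_of_mem (by exact hx)]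
    rfl
  · have : {y : X | (x, y) ∈ A ∩ {p | p.2 = g • p.1} ∩ graph G X} = ∅ := by
      ext y
      simp only [Set.mem_ofPred_eq, Set.mem_empty_iff_false, iff_false]
      rintro ⟨⟨h, hy⟩, -⟩
      exact hx (hy ▸ h)
    rw [layerCount, this, measure_empty, Set.indicator_of_notMem (by exact hx)]

theorem graphMeasure_restrict_diagonal :
    (graphMeasure G μ).restrict (Set.diagonal X) = μ.map fun x => (x, x) := by
  have := graphMeasure_restrict_translationGraph G μ 1
  simp only [one_smul] at this
  rw [← this]
  congr 1
  ext p
  exact eq_comm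

variable [SMulInvariantMeasure G X μ]

/-- The measure `M` is symmetric. It is carried by the countably many graphs of translations; the
swap exchanges the graphs of `g` and `g⁻¹`, and the invariance of `μ` matches the two image
measures. -/
theorem measurePreserving_swap_graphMeasure :
    MeasurePreserving Prod.swap (graphMeasure G μ) (graphMeasure G μ) := by
  refine ⟨measurable_swap, ?_⟩
  have hmem : ∀ᵐ p ∂graphMeasure G μ, p ∈ graph G X := graphMeasure_compl_graph G μ
  have hunion : graph G X = ⋃ g : G, {p : X × X | p.2 = g • p.1} := by
    ext p; simp [graph]
  have hms : MeasurableSet (graph G X) := by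
    rw [hunion]
    exact MeasurableSet.iUnion (measurableSet_translationGraph G)
  have hsymm : ∀ p : X × X, p ∈ graph G X → p.swap ∈ graph G X := by
    rintro p ⟨g, hg⟩
    exact ⟨g⁻¹, by simp [hg]⟩
  have hmem' : ∀ᵐ p ∂(graphMeasure G μ).map Prod.swap, p ∈ graph G X := by
    refine (ae_map_iff measurable_swap.aemeasurable hms).2 ?_
    exact hmem.mono hsymm
  refine (Measure.restrict_eq_self_of_ae_mem hmem').symm.trans
    (Eq.trans ?_ (Measure.restrict_eq_self_of_ae_mem hmem))
  rw [hunion, Measure.restrict_iUnion_congr]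
  intro g
  rw [Measure.restrict_map measurable_swap (measurableSet_translationGraph G g)]
  have : Prod.swap ⁻¹' {p : X × X | p.2 = g • p.1} = {p | p.2 = g⁻¹ • p.1} := by
    ext p
    simp [eq_inv_smul_iff, eq_comm]
  have hg : Measurable fun x : X => (x, g • x) := measurable_id.prodMk (measurable_const_smul g)
  have hg' : Measurable fun x : X => (x, g⁻¹ • x) :=
    measurable_id.prodMk (measurable_const_smul g⁻¹)
  rw [this, graphMeasure_restrict_translationGraph, graphMeasure_restrict_translationGraph,
    Measure.map_map measurable_swap hg', ← (measurePreserving_smul g μ).map_eq,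
    Measure.map_map (measurable_swap.comp hg') (measurable_const_smul g),
    (measurePreserving_smul g μ).map_eq]
  congr 1
  funext x
  simp

/-- The unitary involution `(F h)(x, y) = h(y, x)` of `L²(Π, M)`. -/
def swapL2 : L2 G μ ≃ₗᵢ[ℂ] L2 G μ :=
  have h (f : L2 G μ) : Lp.compMeasurePreserving _ (measurePreserving_swap_graphMeasure G μ)
      (Lp.compMeasurePreserving _ (measurePreserving_swap_graphMeasure G μ) f) = f := by
    rw [← Lp.compMeasurePreserving_comp_apply]
    convert Lp.compMeasurePreserving_id_apply f
    funext p
    simp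
  { LinearEquiv.ofInvolutive
      (Lp.compMeasurePreservingₗ ℂ _ (measurePreserving_swap_graphMeasure G μ)) h with
    norm_map' := fun f => Lp.norm_compMeasurePreserving f _ }

theorem swapL2_apply (f : L2 G μ) : swapL2 G μ f =
    Lp.compMeasurePreserving _ (measurePreserving_swap_graphMeasure G μ) f := rfl

theorem groupoidRep_apply (g : G) (f : L2 G μ) : groupoidRep G μ g f =
    Lp.compMeasurePreserving _ (measurePreserving_left G μ g⁻¹) f := rfl

theorem swapL2_swapL2 (f : L2 G μ) : swapL2 G μ (swapL2 G μ f) = f :=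
  (swapL2 G μ).toLinearEquiv.left_inv f

theorem coeFn_swapL2 (f : L2 G μ) : swapL2 G μ f =ᵐ[graphMeasure G μ] fun p => f p.swap :=
  Lp.coeFn_compMeasurePreserving f (measurePreserving_swap_graphMeasure G μ)

/-- The right translations `(V_g h)(x, y) = h(x, g⁻¹ y)`, obtained from the left translations `U_g`
by exchanging the coordinates. -/
def rightRep (g : G) : L2 G μ ≃ₗᵢ[ℂ] L2 G μ :=
  ((swapL2 G μ).trans (groupoidRep G μ g)).trans (swapL2 G μ)

theorem rightRep_apply (g : G) (f : L2 G μ) :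
    rightRep G μ g f = swapL2 G μ (groupoidRep G μ g (swapL2 G μ f)) := rfl

theorem rightRep_groupoidRep (g h : G) (f : L2 G μ) :
    rightRep G μ g (groupoidRep G μ h f) = groupoidRep G μ h (rightRep G μ g f) := by
  simp only [rightRep_apply, swapL2_apply, groupoidRep_apply, ← Lp.compMeasurePreserving_comp_apply]
  congr 1

theorem coeFn_rightRep (g : G) (f : L2 G μ) :
    rightRep G μ g f =ᵐ[graphMeasure G μ] fun p => f (p.1, g⁻¹ • p.2) := by
  simp only [rightRep_apply, swapL2_apply, groupoidRep_apply, ← Lp.compMeasurePreserving_comp_apply]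
  exact Lp.coeFn_compMeasurePreserving f _

/-! ### The diagonal vector -/

section Diagonal

variable [IsFiniteMeasure μ]

omit [SMulInvariantMeasure G X μ] in
theorem coeFn_diagonalVector : diagonalVector G μ =ᵐ[graphMeasure G μ]
    (Set.diagonal X).indicator fun _ => (1 : ℂ) :=
  indicatorConstLp_coeFn

theorem rightRep_diagonalVector (g : G) :
    rightRep G μ g (diagonalVector G μ) = groupoidRep G μ g⁻¹ (diagonalVector G μ) := by
  simp only [rightRep_apply, swapL2_apply, groupoidRep_apply, ← Lp.compMeasurePreserving_comp_apply]
  rw [diagonalVector, Lp.indicatorConstLp_compMeasurePreserving,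
    Lp.indicatorConstLp_compMeasurePreserving]
  congr 1
  ext p
  simp [eq_inv_smul_iff]

theorem rightRep_groupoidRep_diagonalVector (g h : G) :
    rightRep G μ g (groupoidRep G μ h (diagonalVector G μ)) =
      groupoidRep G μ (h * g⁻¹) (diagonalVector G μ) := by
  rw [rightRep_groupoidRep, rightRep_diagonalVector, map_mul]
  rfl

theorem inner_groupoidRep_diagonalVector (g : G) :
    inner ℂ (groupoidRep G μ g (diagonalVector G μ)) (diagonalVector G μ) =
      fixedPointFunction μ g := by
  rw [groupoidRep_apply, diagonalVector, Lp.indicatorConstLp_compMeasurePreserving,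
    L2.inner_indicatorConstLp_indicatorConstLp (hμs := ?_) (hμt := ?_)]
  rotate_left
  · rw [(measurePreserving_left G μ g⁻¹).measure_preimage
      measurableSet_diagonal.nullMeasurableSet, graphMeasure_diagonal]
    exact measure_ne_top μ _
  · rw [graphMeasure_diagonal]
    exact measure_ne_top μ _
  have hm : MeasurableSet ((fun p : X × X => (g⁻¹ • p.1, p.2)) ⁻¹' Set.diagonal X) :=
    (measurePreserving_left G μ g⁻¹).measurable measurableSet_diagonal
  have hd : Measurable fun x : X => (x, x) := measurable_id.prodMk measurable_id
  have : (graphMeasure G μ).real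
      ((fun p : X × X => (g⁻¹ • p.1, p.2)) ⁻¹' Set.diagonal X ∩ Set.diagonal X) =
      μ.real {x | g • x = x} := by
    rw [measureReal_def, ← Measure.restrict_apply hm, graphMeasure_restrict_diagonal,
      Measure.map_apply hd hm, measureReal_def]
    congr 2
    ext x
    exact inv_smul_eq_iff.trans eq_comm
  rw [this]
  simp [fixedPointFunction]

end Diagonal

/-! ### The character of fixed points -/

omit [Countable G] in
theorem fixedPointFunction_conj (g h : G) :
    fixedPointFunction μ (g * h * g⁻¹) = fixedPointFunction μ h := by
  have : {x : X | (g * h * g⁻¹) • x = x} = (g⁻¹ • ·) ⁻¹' {x : X | h • x = x} := by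
    ext x
    simp [mul_smul, eq_inv_smul_iff]
  rw [fixedPointFunction, this, measureReal_def,
    (measurePreserving_smul g⁻¹ μ).measure_preimage]
  · rfl
  · exact (measurableSet_eq_fun (measurable_const_smul h) measurable_id).nullMeasurableSet

variable [IsProbabilityMeasure μ]

theorem inner_groupoidRep_groupoidRep_diagonalVector (g h : G) :
    inner ℂ (groupoidRep G μ g (diagonalVector G μ)) (groupoidRep G μ h (diagonalVector G μ)) =
      fixedPointFunction μ (g * h⁻¹) := by
  have : groupoidRep G μ g (diagonalVector G μ) =
      groupoidRep G μ h (groupoidRep G μ (h⁻¹ * g) (diagonalVector G μ)) := by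
    rw [← Function.comp_apply (f := groupoidRep G μ h), ← LinearIsometryEquiv.coe_mul, ← map_mul,
      mul_inv_cancel_left]
  rw [this, LinearIsometryEquiv.inner_map_map, inner_groupoidRep_diagonalVector,
    ← fixedPointFunction_conj G μ h]
  congr 1
  group

theorem isCharacter_fixedPointFunction :
    IsCharacter fun g : G => fixedPointFunction μ g where
  posDef n g := by
    have : (Matrix.of fun i j : Fin n => fixedPointFunction μ (g i * (g j)⁻¹)) =
        Matrix.gram ℂ fun i => groupoidRep G μ (g i) (diagonalVector G μ) :=
      Matrix.ext fun i j => (inner_groupoidRep_groupoidRep_diagonalVector G μ (g i) (g j)).symm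
    rw [this]
    exact Matrix.posSemidef_gram ℂ _
  central := fixedPointFunction_conj G μ
  normalized := by simp [fixedPointFunction]

end GraphMeasure

/-! ### Operators commuting with the left and right translations -/

section Commutant

/-- A measurable function which every element of an ergodically acting group leaves invariant
almost everywhere is almost everywhere constant. -/
theorem exists_ae_eq_const_of_ergodic (G : Type*) [Group G] {X : Type*} [MeasurableSpace X]
    [MulAction G X] {μ : Measure X} [ErgodicSMul G X μ] {f : X → ℂ}
    (hf : AEMeasurable f μ) (h : ∀ g : G, (fun x => f (g • x)) =ᵐ[μ] f) :
    ∃ c, f =ᵐ[μ] fun _ => c := by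
  refine Filter.exists_eventuallyEq_const_of_forall_separating MeasurableSet fun U hU => ?_
  have := aeconst_of_forall_preimage_smul_ae_eq G (s := f ⁻¹' U) (μ := μ)
    (hf.nullMeasurable hU) fun g => by
      filter_upwards [h g] with x hx
      exact congrArg (· ∈ U) hx
  simpa [Filter.eventuallyConst_set] using this

variable {G : Type*} [Group G] {X : Type*} [MeasurableSpace X] [MulAction G X]
  [StandardBorelSpace X] [Countable G] [MeasurableConstSMul G X] {μ : Measure X}

/-- If the `U_g` already generate the whole groupoid algebra, then an operator commuting with all
`U_g` commutes with all multiplications by functions of `x`. -/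
theorem map_multiplier_of_commute [SMulInvariantMeasure G X μ]
    (hgen : groupAlgebra G μ = groupoidAlgebra G μ) {T : L2 G μ →L[ℂ] L2 G μ}
    (hT : ∀ g x, T (groupoidRep G μ g x) = groupoidRep G μ g (T x))
    (f : X → ℂ) (hf : Measurable f) (hb : ∃ C : ℝ, ∀ x, ‖f x‖ ≤ C) (x : L2 G μ) :
    T (multiplier G μ f hf hb x) = multiplier G μ f hf hb (T x) := by
  -- The commutant is taken of the star-closure, so that `U_g† = U_{g⁻¹}` has to be treated as well.
  have hTc : T ∈ StarSubalgebra.centralizer ℂ (groupOperators G μ) := by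
    rw [StarSubalgebra.mem_centralizer_iff]
    rintro _ ⟨g, rfl⟩
    refine ⟨ContinuousLinearMap.ext fun x => (hT g x).symm, ContinuousLinearMap.ext fun x => ?_⟩
    rw [ContinuousLinearMap.star_eq_adjoint, LinearIsometryEquiv.adjoint_eq_symm,
      ← LinearIsometryEquiv.inv_def, ← map_inv]
    exact (hT g⁻¹ x).symm
  have hM : multiplier G μ f hf hb ∈ groupAlgebra G μ := by
    rw [hgen]
    change _ ∈ StarSubalgebra.centralizer ℂ _
    rw [StarSubalgebra.mem_centralizer_iff]
    intro S hS
    have hS' := (StarSubalgebra.mem_centralizer_iff ℂ).1 (star_mem hS)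
    have hS := (StarSubalgebra.mem_centralizer_iff ℂ).1 hS
    have hmem : multiplier G μ f hf hb ∈ groupOperators G μ ∪ multipliers G μ :=
      Or.inr ⟨f, hf, hb, rfl⟩
    exact ⟨(hS _ hmem).1.symm, (hS' _ hmem).1.symm⟩
  have := ((StarSubalgebra.mem_centralizer_iff ℂ).1 hM T hTc).1
  exact congrArg (fun L : L2 G μ →L[ℂ] L2 G μ => L x) this

/-- An operator commuting with all `U_g` and all `V_g` commutes with the multiplications by functions
of `x` and, after conjugation by the swap, by functions of `y`. Therefore it keeps the property of
`1_Δ` of being annihilated by every `1_A(x) 1_{Aᶜ}(y)`, and countably many of these sets `A × Aᶜ`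
cover the complement of the diagonal. -/
theorem ae_eq_zero_off_diagonal [IsFiniteMeasure μ] [SMulInvariantMeasure G X μ]
    (hgen : groupAlgebra G μ = groupoidAlgebra G μ) {T : L2 G μ →L[ℂ] L2 G μ}
    (hT : ∀ g x, T (groupoidRep G μ g x) = groupoidRep G μ g (T x))
    (hT' : ∀ g x, T (rightRep G μ g x) = rightRep G μ g (T x)) :
    ∀ᵐ p ∂graphMeasure G μ, p.1 ≠ p.2 → T (diagonalVector G μ) p = 0 := by
  let T' : L2 G μ →L[ℂ] L2 G μ := ((swapL2 G μ).toContinuousLinearEquiv : L2 G μ →L[ℂ] L2 G μ) ∘L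
    T ∘L ((swapL2 G μ).toContinuousLinearEquiv : L2 G μ →L[ℂ] L2 G μ)
  have hT'_apply : ∀ x, T' x = swapL2 G μ (T (swapL2 G μ x)) := fun _ => rfl
  have hcomm : ∀ g x, T' (groupoidRep G μ g x) = groupoidRep G μ g (T' x) := by
    intro g x
    have := hT' g (swapL2 G μ x)
    rw [rightRep_apply, rightRep_apply, swapL2_swapL2] at this
    rw [hT'_apply, hT'_apply, this, swapL2_swapL2]
  have hbd : ∀ A : Set X, ∃ C : ℝ, ∀ x, ‖A.indicator (fun _ => (1 : ℂ)) x‖ ≤ C := fun A =>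
    ⟨1, fun x => (norm_indicator_le_norm_self _ x).trans (by simp)⟩
  have key : ∀ A : Set X, MeasurableSet A → ∀ᵐ p ∂graphMeasure G μ,
      p.1 ∈ A → p.2 ∉ A → T (diagonalVector G μ) p = 0 := by
    intro A hA
    let M := multiplier G μ (A.indicator fun _ => (1 : ℂ)) (measurable_const.indicator hA) (hbd A)
    let M' := multiplier G μ (Aᶜ.indicator fun _ => (1 : ℂ)) (measurable_const.indicator hA.compl)
      (hbd Aᶜ)
    have hcoe : ∀ h : L2 G μ, M (swapL2 G μ (M' (swapL2 G μ h))) =ᵐ[graphMeasure G μ]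
        fun p => A.indicator (fun _ => (1 : ℂ)) p.1 *
          (Aᶜ.indicator (fun _ => (1 : ℂ)) p.2 * h p) := by
      intro h
      have hq := (measurePreserving_swap_graphMeasure G μ).quasiMeasurePreserving
      filter_upwards [coeFn_multiplier G μ _ (measurable_const.indicator hA) (hbd A)
          (swapL2 G μ (M' (swapL2 G μ h))), coeFn_swapL2 G μ (M' (swapL2 G μ h)),
        hq.ae (coeFn_multiplier G μ _ (measurable_const.indicator hA.compl) (hbd Aᶜ)
          (swapL2 G μ h)), hq.ae (coeFn_swapL2 G μ h)] with p h1 h2 h3 h4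
      rw [h1, h2, h3, h4]
      simp
    have hz : M (swapL2 G μ (M' (swapL2 G μ (diagonalVector G μ)))) = 0 := by
      refine Lp.ext ?_
      filter_upwards [hcoe (diagonalVector G μ), coeFn_diagonalVector G μ,
        Lp.coeFn_zero ℂ 2 (graphMeasure G μ)] with p h1 h2 h3
      rw [h1, h2, h3]
      by_cases h : p.1 = p.2
      · by_cases hpA : p.2 ∈ A <;> simp [h, hpA]
      · rw [Set.indicator_of_notMem (s := Set.diagonal X) (by exact h)]
        simp
    have hTz : M (swapL2 G μ (M' (swapL2 G μ (T (diagonalVector G μ))))) = 0 := by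
      have h2 := map_multiplier_of_commute hgen hcomm _ (measurable_const.indicator hA.compl)
        (hbd Aᶜ) (swapL2 G μ (diagonalVector G μ))
      rw [hT'_apply, hT'_apply, swapL2_swapL2] at h2
      rw [← h2, swapL2_swapL2, ← map_multiplier_of_commute hgen hT, hz, map_zero]
    filter_upwards [hcoe (T (diagonalVector G μ)), Lp.coeFn_zero ℂ 2 (graphMeasure G μ)]
      with p h1 h2 hp1 hp2
    rw [hTz, h2] at h1
    simpa [hp1, hp2] using h1.symm
  obtain ⟨S, hS, hsep⟩ := exists_seq_separating X MeasurableSet.univ Set.univ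
  filter_upwards [ae_all_iff.2 fun n => key _ (hS n), ae_all_iff.2 fun n => key _ (hS n).compl]
    with p h1 h2 hne
  by_contra h0
  refine hne (hsep _ trivial _ trivial fun n => ⟨fun h => ?_, fun h => ?_⟩)
  · by_contra h'
    exact h0 (h1 n h h')
  · by_contra h'
    exact h0 (h2 n h' fun h'' => h'' h)

/-- An operator commuting with all `U_g` and all `V_g` has `1_Δ` as an eigenvector: its image of `1_Δ`
is supported on the diagonal and is invariant under `U_g V_g`, which acts on the diagonal as `g`
acts on `X`, so ergodicity applies. -/
theorem exists_map_diagonalVector_eq_smul [IsProbabilityMeasure μ] [ErgodicSMul G X μ]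
    (hgen : groupAlgebra G μ = groupoidAlgebra G μ) {T : L2 G μ →L[ℂ] L2 G μ}
    (hT : ∀ g x, T (groupoidRep G μ g x) = groupoidRep G μ g (T x))
    (hT' : ∀ g x, T (rightRep G μ g x) = rightRep G μ g (T x)) :
    ∃ c : ℂ, T (diagonalVector G μ) = c • diagonalVector G μ := by
  set u := T (diagonalVector G μ) with hu
  have hd : Measurable fun x : X => (x, x) := measurable_id.prodMk measurable_id
  have hdiag : ∀ {P : X × X → Prop}, (∀ᵐ p ∂graphMeasure G μ, P p) → ∀ᵐ x ∂μ, P (x, x) := by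
    intro P hP
    have := ae_restrict_of_ae (s := Set.diagonal X) hP
    rw [graphMeasure_restrict_diagonal] at this
    exact ae_of_ae_map hd.aemeasurable this
  have hinv : ∀ g : G, (fun x => u (g • x, g • x)) =ᵐ[μ] fun x => u (x, x) := by
    intro g
    have h1 : rightRep G μ g⁻¹ (groupoidRep G μ g⁻¹ u) = u := by
      rw [hu, ← hT, ← hT', rightRep_groupoidRep_diagonalVector]
      simp
    have hq : Measure.QuasiMeasurePreserving (fun p : X × X => (p.1, g • p.2))
        (graphMeasure G μ) (graphMeasure G μ) :=
      (((measurePreserving_swap_graphMeasure G μ).comp (measurePreserving_left G μ g)).comp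
        (measurePreserving_swap_graphMeasure G μ)).quasiMeasurePreserving
    have h2 : ∀ᵐ p ∂graphMeasure G μ, u (g • p.1, g • p.2) = u p := by
      have h3 := coeFn_rightRep G μ g⁻¹ (groupoidRep G μ g⁻¹ u)
      rw [h1] at h3
      filter_upwards [h3, hq.ae (coeFn_groupoidRep G μ g⁻¹ u)] with p h4 h5
      rw [h4, inv_inv, h5, inv_inv]
    exact hdiag h2
  obtain ⟨c, hc⟩ := exists_ae_eq_const_of_ergodic G (μ := μ)
    (f := fun x => u (x, x)) ((Lp.stronglyMeasurable u).measurable.comp hd).aemeasurable hinv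
  refine ⟨c, Lp.ext ?_⟩
  have hc' : ∀ᵐ p ∂graphMeasure G μ, p ∈ Set.diagonal X → u p = c := by
    rw [← ae_restrict_iff' measurableSet_diagonal, graphMeasure_restrict_diagonal,
      ae_map_iff hd.aemeasurable
        (measurableSet_eq_fun (Lp.stronglyMeasurable u).measurable measurable_const)]
    exact hc
  filter_upwards [hc', ae_eq_zero_off_diagonal hgen hT hT', coeFn_diagonalVector G μ,
    Lp.coeFn_smul c (diagonalVector G μ)] with p h1 h2 h3 h4
  rw [h4, Pi.smul_apply, h3]
  by_cases hp : p ∈ Set.diagonal X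
  · rw [Set.indicator_of_mem hp, h1 hp, smul_eq_mul, mul_one]
  · rw [Set.indicator_of_notMem hp, h2 hp, smul_zero]

/-- A character `ψ` with a positive multiple dominated by `φ` equals `φ`. -/
theorem eq_fixedPointFunction_of_dominated [IsProbabilityMeasure μ] [ErgodicSMul G X μ]
    (hgen : groupAlgebra G μ = groupoidAlgebra G μ) {ψ ψ' : G → ℂ} (hψ : IsCharacter ψ)
    (hψ' : IsCharacter ψ') {a b : ℝ} (ha : 0 < a) (hb : 0 ≤ b)
    (h : ∀ g, fixedPointFunction μ g = a * ψ g + b * ψ' g) :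
    ψ = fun g => fixedPointFunction μ g := by
  obtain ⟨T, hTψ, hTU⟩ := exists_clm_of_kernel_le_gram
    (fun g : G => groupoidRep G μ g (diagonalVector G μ)) hψ.posSemidef ha (by
      convert hψ'.posSemidef.smul hb using 1
      ext g h'
      simp [inner_groupoidRep_groupoidRep_diagonalVector, h])
  -- `U_g` and `V_g` permute the vectors `U_h 1_Δ` by `h ↦ g h` and `h ↦ h g⁻¹`; centrality of `ψ`
  -- makes the kernel `ψ (h k⁻¹)` invariant under the first permutation.
  have hT : ∀ g x, T (groupoidRep G μ g x) = groupoidRep G μ g (T x) := by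
    intro g x
    refine hTU _ (Equiv.mulLeft g) (fun h => ?_) (fun h k => ?_) x
    · rw [Equiv.coe_mulLeft, map_mul]
      rfl
    · simp only [Matrix.of_apply, Equiv.coe_mulLeft]
      rw [← hψ.central g (h * k⁻¹)]
      congr 1
      group
  have hT' : ∀ g x, T (rightRep G μ g x) = rightRep G μ g (T x) := by
    intro g x
    refine hTU _ (Equiv.mulRight g⁻¹) (fun h => ?_) (fun h k => ?_) x
    · exact rightRep_groupoidRep_diagonalVector G μ g h
    · simp
  obtain ⟨c, hc⟩ := exists_map_diagonalVector_eq_smul hgen hT hT'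
  have hval : ∀ g, ψ g = star c * fixedPointFunction μ g := by
    intro g
    have h1 := hTψ g 1
    simp only [hT, hc, map_smul, inner_smul_left, Matrix.of_apply, inv_one, mul_one,
      inner_groupoidRep_groupoidRep_diagonalVector] at h1
    exact h1.symm
  have h1 := hval 1
  rw [hψ.normalized, (isCharacter_fixedPointFunction G μ).normalized, mul_one] at h1
  funext g
  rw [hval, ← h1, one_mul]

end Commutant

end GroupoidRep

end

theorem theorem9 {G : Type*} [Group G] [Countable G]
    {X : Type*} [MeasurableSpace X] [StandardBorelSpace X]
    [MulAction G X] [MeasurableConstSMul G X]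
    (μ : MeasureTheory.Measure X) [MeasureTheory.IsProbabilityMeasure μ] [ErgodicSMul G X μ] :
    GroupoidRep.IsCharacter (fun g : G => GroupoidRep.fixedPointFunction μ g) ∧
    (∀ g : G, inner ℂ (GroupoidRep.groupoidRep G μ g (GroupoidRep.diagonalVector G μ))
        (GroupoidRep.diagonalVector G μ) = GroupoidRep.fixedPointFunction μ g) ∧
    (GroupoidRep.groupAlgebra G μ = GroupoidRep.groupoidAlgebra G μ →
      GroupoidRep.IsIndecomposableCharacter (fun g : G => GroupoidRep.fixedPointFunction μ g)) := by
  refine ⟨GroupoidRep.isCharacter_fixedPointFunction G μ,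
    GroupoidRep.inner_groupoidRep_diagonalVector G μ, fun hgen => ?_⟩
  refine mem_extremePoints.2 ⟨GroupoidRep.isCharacter_fixedPointFunction G μ, ?_⟩
  rintro ψ hψ ψ' hψ' ⟨a, b, ha, hb, -, h⟩
  have hφ : ∀ g, GroupoidRep.fixedPointFunction μ g = a * ψ g + b * ψ' g := fun g => by
    rw [← congrFun h g]
    simp
  exact ⟨GroupoidRep.eq_fixedPointFunction_of_dominated hgen hψ hψ' ha hb.le hφ,
    GroupoidRep.eq_fixedPointFunction_of_dominated hgen hψ' hψ hb ha.le
      fun g => (hφ g).trans (add_comm _ _)⟩
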